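/- **Definitions.** All graphs are simple, finite and undirected. In a graph $G$ whose vertices and edges are all colored (adjacent or incident elements may receive the same color), a path is a *total proper path* if any two consecutive edges of the path differ in color, any two consecutive internal vertices of the path differ in color, and every internal vertex of the path differs in color from the two edges of the path incident with it. The *total proper connection number* $tpc(G)$ of a connected graph $G$ is the smallest number of colors in a coloring of the vertices and edges of $G$ such that any two vertices of $G$ are connected by a total proper path. **Proposition 3.** Let $k\ge 2$. Let $G$ be the graph obtained from an even cycle of length $4\cdot 2^{k}$, divided by four vertices $u_1,u_2,u_3,u_4$ (in cyclic order) into four segments of $2^{k}$ edges each, by adding two ears of length $2^{k}$: a path joining $u_1$ and $u_2$ and a path joining $u_3$ and $u_4$, whose internal vertices are new and distinct. Then $G$ is 2-connected and bipartite, and $tpc(G)=4$. (Hence the upper bound $4$ for the total proper connection number of 2-connected graphs, proved in the same paper, is sharp, even among bipartite graphs.) -/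

import Mathlib

namespace TotalProper

variable {V : Type*}

/-- A path `p` (a walk that repeats no vertex) is a total proper path for the colors `cv` of the
vertices and `ce` of the edges if consecutive edges of the path differ in color, consecutive
internal vertices of the path differ in color, and every internal vertex of the path differs in
color from the two edges of the path that are incident with it. The internal vertices of `p` are
the `p.getVert i` with `0 < i < p.length`. -/
structure IsTotalProperPath {α : Type*} (G : SimpleGraph V) (cv : V → α) (ce : Sym2 V → α)
    {u v : V} (p : G.Walk u v) : Prop where
  isPath : p.IsPath
  edge_ne_edge : ∀ i, i + 2 ≤ p.length →
    ce s(p.getVert i, p.getVert (i + 1)) ≠ ce s(p.getVert (i + 1), p.getVert (i + 2))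
  vert_ne_vert : ∀ i, 0 < i → i + 1 < p.length →
    cv (p.getVert i) ≠ cv (p.getVert (i + 1))
  vert_ne_edge : ∀ i, i + 2 ≤ p.length →
    cv (p.getVert (i + 1)) ≠ ce s(p.getVert i, p.getVert (i + 1)) ∧
    cv (p.getVert (i + 1)) ≠ ce s(p.getVert (i + 1), p.getVert (i + 2))

/-- The total-coloring `(cv, ce)` makes `G` total proper connected: any two vertices are joined by
a total proper path. (Only the values of `ce` at edges of `G` matter.) -/
def IsTotalProperConnected {α : Type*} (G : SimpleGraph V) (cv : V → α) (ce : Sym2 V → α) : Prop :=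
  ∀ u v : V, ∃ p : G.Walk u v, IsTotalProperPath G cv ce p

/-- The total proper connection number: the least `n` such that some total-coloring of `G` with
colors from one set of `n` colors makes `G` total proper connected. -/
noncomputable def tpc (G : SimpleGraph V) : ℕ :=
  sInf {n : ℕ | ∃ (cv : V → Fin n) (ce : Sym2 V → Fin n), IsTotalProperConnected G cv ce}

/-- A graph is 2-connected if it is connected, has at least three vertices, and stays connected
when any one vertex is deleted. -/
def IsTwoConnected (G : SimpleGraph V) : Prop :=
  G.Connected ∧ 3 ≤ Nat.card V ∧ ∀ v : V, (G.induce {v}ᶜ).Connected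

/-- Vertices of the cycle with two ears whose six segments have `L` edges: the four vertices
`u₀, u₁, u₂, u₃` at the ends of the segments, and `L - 1` internal vertices in each segment. The
segments are numbered so that `0, 1, 2, 3` are the segments of the cycle, in cyclic order, and `4`
and `5` are the ears that join the ends of the segments `0` and `2`, respectively. -/
abbrev EarVertex (L : ℕ) : Type := Fin 4 ⊕ (Fin 6 × Fin (L - 1))

/-- The index of the first vertex of each segment. -/
def segStart : Fin 6 → Fin 4 := ![0, 1, 2, 3, 0, 2]

/-- The index of the last vertex of each segment. -/
def segEnd : Fin 6 → Fin 4 := ![1, 2, 3, 0, 1, 3]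

/-- The `i`-th vertex of the segment `s`, for `0 ≤ i ≤ L`. -/
def segVertex (L : ℕ) (s : Fin 6) (i : ℕ) : EarVertex L :=
  if i = 0 then Sum.inl (segStart s)
  else if h : i - 1 < L - 1 then Sum.inr (s, ⟨i - 1, h⟩)
  else Sum.inl (segEnd s)

/-- The graph obtained from a cycle with `4 * L` edges, divided into four consecutive segments of
`L` edges each, by adding two ears of length `L`, one joining the ends of the first segment and the
other joining the ends of the third: two vertices are adjacent if and only if they are consecutive
in one of the six segments. -/
def cycleWithTwoEars (L : ℕ) : SimpleGraph (EarVertex L) :=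
  SimpleGraph.fromRel fun x y => ∃ (s : Fin 6) (i : ℕ),
    i < L ∧ x = segVertex L s i ∧ y = segVertex L s (i + 1)

end TotalProper

/-!
For the upper bound, let `c` count modulo 4 the steps from `u₀` when all segments are traversed
from start to end. These directions make the graph strongly connected, and giving the color
`2 * c x` to the vertex `x` and `c x + c y` to the edge `xy` turns every path that follows them into
a total proper path. Modulo 2, `c` is a bipartition.

For the lower bound, consider a total-coloring with three colors as a vertex coloring of the
subdivision in which every edge gets a midpoint. With only three colors, the color of consecutive
vertices on a total proper path always increases by one modulo 3 or always decreases by one. A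
segment that is not monotone contains a turn, and the turn traps all ascending, or all descending,
walks that start near one of its ends; two segments cannot both trap ascending walks, or both
descending ones, so at most two segments are not monotone. Two ascending segments never lead to the
same junction, since vertices in their interiors could not be joined; likewise for descending ones.
Hence one of the three segments at each junction is not monotone, so that the two segments that are
not monotone cover all junctions, the other two segments at each junction are monotone, and one of
these ascends from the junction. Following such segments closes up after two or four of them, but
the color then changes by two or four times the length of a segment, which is not divisible by 3.
-/

namespace TotalProper

section ColorStep

variable {V R : Type*} {G : SimpleGraph V} {c : V → R} {x y : V}

/-- The directed edges of `G` along which the coloring `c` increases by one. -/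
def ColorStep [Add R] [One R] (G : SimpleGraph V) (c : V → R) (x y : V) : Prop :=
  G.Adj x y ∧ c y = c x + 1

/-- Reachability along directed walks on which the coloring `c` increases by one at each step. -/
abbrev ColorReach [Add R] [One R] (G : SimpleGraph V) (c : V → R) : V → V → Prop :=
  Relation.ReflTransGen (ColorStep G c)

theorem ColorStep.asymm [Ring R] (h2 : (2 : R) ≠ 0) (h : ColorStep G c x y) :
    ¬ ColorStep G c y x := fun h' => h2 <| by
  rw [← one_add_one_eq_two, ← add_eq_left (a := c x), ← add_assoc, ← h.2, h'.2.symm]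

theorem colorStep_neg [Ring R] : ColorStep G (-c) x y ↔ ColorStep G c y x := by
  rw [ColorStep, ColorStep, G.adj_comm, Pi.neg_apply, Pi.neg_apply, neg_eq_iff_eq_neg, neg_add,
    neg_neg, ← sub_eq_add_neg, eq_sub_iff_add_eq, eq_comm]

theorem colorReach_neg [Ring R] : ColorReach G (-c) x y ↔ ColorReach G c y x := by
  have : ColorStep G (-c) = Function.swap (ColorStep G c) :=
    funext₂ fun _ _ => propext colorStep_neg
  rw [ColorReach, this, Relation.reflTransGen_swap]

theorem ColorReach.exists_isPath [Add R] [One R] (h : ColorReach G c x y) :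
    ∃ p : G.Walk x y, p.IsPath ∧
      ∀ i < p.length, c (p.getVert (i + 1)) = c (p.getVert i) + 1 := by
  classical
  obtain ⟨p, hp⟩ : ∃ p : G.Walk x y, ∀ d ∈ p.darts, c d.snd = c d.fst + 1 := by
    induction h using Relation.ReflTransGen.head_induction_on with
    | refl => exact ⟨.nil, by simp⟩
    | head hstep _ ih =>
      obtain ⟨p, hp⟩ := ih
      exact ⟨.cons hstep.1 p, by simpa using ⟨hstep.2, hp⟩⟩
  refine ⟨p.bypass, p.bypass_isPath, fun i hi => ?_⟩
  have hi' : i < p.bypass.darts.length := by rwa [SimpleGraph.Walk.length_darts]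
  have hstep := hp _ (p.darts_bypass_subset_darts (List.getElem_mem hi'))
  simpa only [SimpleGraph.Walk.darts_getElem_eq_getVert] using hstep

/- Along a directed walk on which `c` increases by one, the vertices and edges get the colors
`2 * a`, `2 * a + 1`, `2 * a + 2`, … in the order in which they are met. -/
theorem isTotalProperConnected_of_colorReach [CommRing R] (h2 : (2 : R) ≠ 0)
    (h : ∀ x y, ColorReach G c x y) :
    IsTotalProperConnected G (fun x => 2 * c x)
      (Sym2.lift ⟨fun x y => c x + c y, fun _ _ => add_comm _ _⟩) := by
  intro x y
  obtain ⟨p, hp, hc⟩ := (h x y).exists_isPath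
  have h1 : (1 : R) ≠ 0 := fun h => h2 (by linear_combination 2 * h)
  refine ⟨p, hp, fun i hi h => h2 ?_, fun i _ hi h => h2 ?_, fun i hi =>
    ⟨fun h => h1 ?_, fun h => h1 ?_⟩⟩
  · simp only [Sym2.lift_mk] at h
    linear_combination -h - hc i (by omega) - hc (i + 1) hi
  · linear_combination -h - 2 * hc i (by omega)
  · simp only [Sym2.lift_mk] at h
    linear_combination h - hc i (by omega)
  · simp only [Sym2.lift_mk] at h
    linear_combination -h - hc (i + 1) hi

theorem IsTotalProperConnected.comp_injective {α β : Type*} {cv : V → α} {ce : Sym2 V → α}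
    {f : α → β} (hf : Function.Injective f) (h : IsTotalProperConnected G cv ce) :
    IsTotalProperConnected G (f ∘ cv) (f ∘ ce) := by
  intro x y
  obtain ⟨p, hp⟩ := h x y
  exact ⟨p, hp.isPath, fun i hi => hf.ne (hp.edge_ne_edge i hi),
    fun i h0 hi => hf.ne (hp.vert_ne_vert i h0 hi),
    fun i hi => (hp.vert_ne_edge i hi).imp hf.ne hf.ne⟩

theorem forall_or_forall_of_consecutive {P Q : ℕ → Prop} {n : ℕ} (hn : n ≠ 1)
    (hPQ : ∀ i, ¬ (P i ∧ Q i)) (h : ∀ i, i + 1 < n → P i ∧ P (i + 1) ∨ Q i ∧ Q (i + 1)) :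
    (∀ i < n, P i) ∨ ∀ i < n, Q i := by
  have propagate {P Q : ℕ → Prop} (hPQ : ∀ i, ¬ (P i ∧ Q i))
      (h : ∀ i, i + 1 < n → P i ∧ P (i + 1) ∨ Q i ∧ Q (i + 1)) (h0 : P 0) (i : ℕ) (hi : i < n) :
      P i := by
    induction i with
    | zero => exact h0
    | succ i ih =>
      exact (h i hi).elim And.right fun hQ => (hPQ i ⟨ih (by omega), hQ.1⟩).elim
  obtain rfl | hn : n = 0 ∨ 0 + 1 < n := by omega
  · simp
  · exact (h 0 hn).imp (fun h0 => propagate hPQ h h0.1) fun h0 =>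
      propagate (fun i => mt And.symm (hPQ i)) (fun i hi => (h i hi).symm) h0.1

theorem two_ne_zero_zmod_three : (2 : ZMod 3) ≠ 0 := by decide

theorem colorReach_or_colorReach_of_forall_ne {c : V → ZMod 3} {g : ℕ → V} {n : ℕ}
    (hn : n ≠ 1) (hadj : ∀ j < n, G.Adj (g j) (g (j + 1)))
    (hne : ∀ j, j + 1 < n → c (g j) ≠ c (g (j + 1)) ∧ c (g (j + 1)) ≠ c (g (j + 2)) ∧
      c (g j) ≠ c (g (j + 2))) :
    ColorReach G c (g 0) (g n) ∨ ColorReach G c (g n) (g 0) := by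
  have turn : ∀ a b e : ZMod 3, a ≠ b ∧ b ≠ e ∧ a ≠ e →
      b = a + 1 ∧ e = b + 1 ∨ a = b + 1 ∧ b = e + 1 := by decide
  have hmono := forall_or_forall_of_consecutive hn
    (P := fun j => ColorStep G c (g j) (g (j + 1))) (Q := fun j => ColorStep G c (g (j + 1)) (g j))
    (fun j h => h.1.asymm two_ne_zero_zmod_three h.2) fun j hj =>
      have hfst := hadj j (by omega)
      have hsnd := hadj (j + 1) hj
      (turn _ _ _ (hne j hj)).imp (fun h => ⟨⟨hfst, h.1⟩, hsnd, h.2⟩)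
        fun h => ⟨⟨hfst.symm, h.1⟩, hsnd.symm, h.2⟩
  have reach {r : V → V → Prop} (h : ∀ j < n, r (g j) (g (j + 1))) :
      Relation.ReflTransGen r (g 0) (g n) :=
    (reflTransGen_of_succ_of_le (fun i j => r (g i) (g j))
      (fun j hj => h j hj.2) n.zero_le).lift g fun _ _ => id
  exact hmono.imp reach fun h => Relation.reflTransGen_swap.1 (reach h)

theorem connected_induce_compl_singleton {v : V} (hx : x ≠ v)
    (h : ∀ y, y ≠ v → (G.deleteIncidenceSet v).Reachable x y) :
    (G.induce {v}ᶜ).Connected := by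
  rw [SimpleGraph.connected_iff_exists_forall_reachable]
  refine ⟨⟨x, hx⟩, fun ⟨y, hy⟩ => ?_⟩
  have hreach := h y hy
  rw [SimpleGraph.reachable_iff_reflTransGen] at hreach
  induction hreach with
  | refl => exact .refl _
  | tail _ hstep ih =>
    rw [SimpleGraph.deleteIncidenceSet_adj] at hstep
    exact (ih hstep.2.1).trans (SimpleGraph.Adj.reachable (by simpa using hstep.1))

end ColorStep

section Segments

variable {L : ℕ}

theorem segVertex_zero (s : Fin 6) : segVertex L s 0 = Sum.inl (segStart s) := by
  simp [segVertex]

theorem segVertex_last (hL : 0 < L) (s : Fin 6) : segVertex L s L = Sum.inl (segEnd s) := by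
  simp [segVertex, hL.ne']

theorem segVertex_succ {i : ℕ} (hi : i + 1 < L) (s : Fin 6) :
    segVertex L s (i + 1) = Sum.inr (s, ⟨i, by omega⟩) := by
  have : i < L - 1 := by omega
  simp [segVertex, this]

theorem segVertex_eq_inl (hL : 0 < L) {s : Fin 6} {i : ℕ} (hi : i ≤ L) {m : Fin 4}
    (h : segVertex L s i = Sum.inl m) : i = 0 ∧ segStart s = m ∨ i = L ∧ segEnd s = m := by
  rcases i with _ | i
  · exact .inl ⟨rfl, by simpa [segVertex_zero] using h⟩
  rcases hi.eq_or_lt with rfl | hi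
  · exact .inr ⟨rfl, by simpa [segVertex_last] using h⟩
  · simp [segVertex_succ hi] at h

theorem segVertex_inj_of_interior {s s' : Fin 6} {i i' : ℕ} (h0 : 0 < i) (hi : i < L)
    (hi' : i' ≤ L) (h : segVertex L s i = segVertex L s' i') : s = s' ∧ i = i' := by
  obtain ⟨i, rfl⟩ := Nat.exists_eq_add_one.2 h0
  rw [segVertex_succ hi] at h
  rcases i' with _ | i'
  · simp [segVertex_zero] at h
  rcases hi'.eq_or_lt with rfl | hi'
  · simp [segVertex_last] at h
  · simpa [segVertex_succ hi'] using h

theorem segStart_ne_segEnd (s : Fin 6) : segStart s ≠ segEnd s := by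
  revert s; decide

theorem segVertex_injOn {s : Fin 6} {i i' : ℕ} (hi : i ≤ L) (hi' : i' ≤ L)
    (h : segVertex L s i = segVertex L s i') : i = i' := by
  by_cases hint : 0 < i ∧ i < L
  · exact (segVertex_inj_of_interior hint.1 hint.2 hi' h).2
  by_cases hint' : 0 < i' ∧ i' < L
  · exact (segVertex_inj_of_interior hint'.1 hint'.2 hi h.symm).2.symm
  by_contra hne
  obtain ⟨rfl, rfl⟩ | ⟨rfl, rfl⟩ : i = 0 ∧ i' = L ∨ i = L ∧ i' = 0 := by omega
  · rw [segVertex_zero, segVertex_last (by omega)] at h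
    exact segStart_ne_segEnd s (Sum.inl_injective h)
  · rw [segVertex_zero, segVertex_last (by omega)] at h
    exact segStart_ne_segEnd s (Sum.inl_injective h).symm

theorem exists_eq_segVertex (hL : 0 < L) (x : EarVertex L) :
    ∃ (s : Fin 6) (i : ℕ), i ≤ L ∧ x = segVertex L s i := by
  rcases x with m | ⟨s, i⟩
  · obtain ⟨s, rfl⟩ : ∃ s, segStart s = m := by revert m; decide
    exact ⟨s, 0, hL.le, (segVertex_zero s).symm⟩
  · exact ⟨s, i + 1, by omega, (segVertex_succ (by omega) s).symm⟩

theorem adj_segVertex (s : Fin 6) {i : ℕ} (hi : i < L) :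
    (cycleWithTwoEars L).Adj (segVertex L s i) (segVertex L s (i + 1)) :=
  (SimpleGraph.fromRel_adj ..).2
    ⟨fun h => i.succ_ne_self (segVertex_injOn hi.le hi h).symm, .inl ⟨s, i, hi, rfl, rfl⟩⟩

theorem exists_eq_segVertex_of_adj {x y : EarVertex L} (h : (cycleWithTwoEars L).Adj x y) :
    ∃ (s : Fin 6) (i : ℕ), i < L ∧ (x = segVertex L s i ∧ y = segVertex L s (i + 1) ∨
      y = segVertex L s i ∧ x = segVertex L s (i + 1)) := by
  rcases ((SimpleGraph.fromRel_adj ..).1 h).2 with ⟨s, i, hi, h⟩ | ⟨s, i, hi, h⟩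
  · exact ⟨s, i, hi, .inl h⟩
  · exact ⟨s, i, hi, .inr h⟩

end Segments

section Phase

variable {L : ℕ}

/-- The distance modulo 4 from `u₀` along the directed walks that traverse all segments from
start to end; all these walks between two vertices have the same length modulo 4. -/
def phase (L : ℕ) : EarVertex L → ZMod 4 :=
  Sum.elim (fun m => L * (m : ℕ)) fun x => L * (segStart x.1 : ℕ) + x.2 + 1

theorem phase_segVertex (hL : 0 < L) (s : Fin 6) {i : ℕ} (hi : i ≤ L) :
    phase L (segVertex L s i) = L * (segStart s : ℕ) + i := by
  rcases i with _ | i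
  · simp [segVertex_zero, phase]
  rcases hi.eq_or_lt with h | hi
  · have hend : ((segEnd s : ℕ) : ZMod 4) = (segStart s : ℕ) + 1 := by revert s; decide
    rw [h, segVertex_last hL, phase, Sum.elim_inl, hend, mul_add_one]
  · simp [segVertex_succ hi, phase, add_assoc]

theorem colorStep_phase_segVertex (s : Fin 6) {i : ℕ} (hi : i < L) :
    ColorStep (cycleWithTwoEars L) (phase L) (segVertex L s i) (segVertex L s (i + 1)) := by
  have hL : 0 < L := by omega
  refine ⟨adj_segVertex s hi, ?_⟩
  rw [phase_segVertex hL s hi.le, phase_segVertex hL s hi, Nat.cast_add_one, add_assoc]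

theorem colorReach_phase_segVertex (s : Fin 6) {i j : ℕ} (hij : i ≤ j) (hj : j ≤ L) :
    ColorReach (cycleWithTwoEars L) (phase L) (segVertex L s i) (segVertex L s j) := by
  induction j, hij using Nat.le_induction with
  | base => exact .refl
  | succ j _ ih => exact (ih (by omega)).tail (colorStep_phase_segVertex s hj)

theorem colorReach_phase_junction (hL : 0 < L) (m m' : Fin 4) :
    ColorReach (cycleWithTwoEars L) (phase L) (Sum.inl m) (Sum.inl m') := by
  have next (m : Fin 4) :
      ColorReach (cycleWithTwoEars L) (phase L) (Sum.inl m) (Sum.inl (m + 1)) := by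
    obtain ⟨s, rfl, hs⟩ : ∃ s, segStart s = m ∧ segEnd s = m + 1 := by revert m; decide
    rw [← hs, ← segVertex_zero, ← segVertex_last hL]
    exact colorReach_phase_segVertex s L.zero_le le_rfl
  obtain rfl | rfl | rfl | rfl :
      m' = m ∨ m' = m + 1 ∨ m' = m + 1 + 1 ∨ m' = m + 1 + 1 + 1 := by
    revert m m'; decide
  · exact .refl
  · exact next _
  · exact (next _).trans (next _)
  · exact ((next _).trans (next _)).trans (next _)

theorem colorReach_phase (hL : 0 < L) (x y : EarVertex L) :
    ColorReach (cycleWithTwoEars L) (phase L) x y := by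
  obtain ⟨s, i, hi, rfl⟩ := exists_eq_segVertex hL x
  obtain ⟨t, j, hj, rfl⟩ := exists_eq_segVertex hL y
  have hx := colorReach_phase_segVertex s hi le_rfl
  have hy := colorReach_phase_segVertex t j.zero_le hj
  rw [segVertex_last hL] at hx
  rw [segVertex_zero] at hy
  exact hx.trans ((colorReach_phase_junction hL _ _).trans hy)

theorem connected_cycleWithTwoEars (hL : 0 < L) : (cycleWithTwoEars L).Connected :=
  have : Nonempty (EarVertex L) := ⟨Sum.inl 0⟩
  ⟨fun x y => (colorReach_phase hL x y).exists_isPath.choose.reachable⟩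

theorem isBipartite_cycleWithTwoEars (L : ℕ) : (cycleWithTwoEars L).IsBipartite := by
  let f := ZMod.castHom (show 2 ∣ 4 by norm_num) (ZMod 2)
  have hf {a b : ZMod 4} (h : b = a + 1) : f a ≠ f b := by simp [h]
  refine (SimpleGraph.Coloring.mk (fun x => f (phase L x)) fun {x y} h => ?_).colorable
  obtain ⟨s, i, hi, ⟨rfl, rfl⟩ | ⟨rfl, rfl⟩⟩ := exists_eq_segVertex_of_adj h
  · exact hf (colorStep_phase_segVertex s hi).2
  · exact (hf (colorStep_phase_segVertex s hi).2).symm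

end Phase

section TwoConnected

variable {L : ℕ} {v : EarVertex L}

theorem reachable_deleteIncidenceSet_segVertex {s : Fin 6} {i j : ℕ} (hij : i ≤ j) (hj : j ≤ L)
    (h : ∀ k, i ≤ k → k ≤ j → segVertex L s k ≠ v) :
    ((cycleWithTwoEars L).deleteIncidenceSet v).Reachable
      (segVertex L s i) (segVertex L s j) := by
  induction j, hij using Nat.le_induction with
  | base => exact .refl _
  | succ j hij ih =>
    refine (ih (by omega) fun k hik hkj => h k hik (by omega)).trans
      (SimpleGraph.Adj.reachable ?_)
    exact SimpleGraph.deleteIncidenceSet_adj.2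
      ⟨adj_segVertex s hj, h j hij (by omega), h (j + 1) (by omega) le_rfl⟩

theorem exists_reachable_deleteIncidenceSet_junction (hL : 0 < L) {x : EarVertex L}
    (hx : x ≠ v) : ∃ m : Fin 4, Sum.inl m ≠ v ∧
      ((cycleWithTwoEars L).deleteIncidenceSet v).Reachable (Sum.inl m) x := by
  obtain ⟨s, j, hj, rfl⟩ := exists_eq_segVertex hL x
  by_cases h : ∃ i ≤ j, segVertex L s i = v
  · obtain ⟨i, hij, rfl⟩ := h
    have avoid (k : ℕ) (hjk : j ≤ k) (hk : k ≤ L) : segVertex L s k ≠ segVertex L s i := by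
      intro hki
      obtain rfl : i = j := by have := segVertex_injOn hk (by omega) hki; omega
      exact hx rfl
    exact ⟨segEnd s, segVertex_last hL s ▸ avoid L hj le_rfl, segVertex_last hL s ▸
      (reachable_deleteIncidenceSet_segVertex hj le_rfl avoid).symm⟩
  · push Not at h
    exact ⟨segStart s, segVertex_zero s ▸ h 0 j.zero_le, segVertex_zero s ▸
      reachable_deleteIncidenceSet_segVertex j.zero_le hj fun k _ hk => h k hk⟩

theorem exists_forall_reachable_deleteIncidenceSet_junction (hL : 0 < L) (v : EarVertex L) :
    ∃ a : Fin 4, Sum.inl a ≠ v ∧ ∀ m : Fin 4, Sum.inl m ≠ v →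
      ((cycleWithTwoEars L).deleteIncidenceSet v).Reachable (Sum.inl a) (Sum.inl m) := by
  obtain ⟨b, hb, hint⟩ : ∃ b : Fin 4, (∀ m ≠ b, Sum.inl m ≠ v) ∧
      ∀ s i, 0 < i → i < L → segVertex L s i = v → segStart s = b := by
    rcases v with b | ⟨t, j⟩
    · refine ⟨b, fun m hm h => hm (Sum.inl_injective h), fun s i h0 hi h => ?_⟩
      have := segVertex_eq_inl hL hi.le h
      omega
    · refine ⟨segStart t, fun m _ => Sum.inl_ne_inr, fun s i h0 hi h => ?_⟩
      rw [← segVertex_succ (i := j) (by omega) t] at h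
      rw [(segVertex_inj_of_interior h0 hi (by omega) h).1]
  have next (m : Fin 4) (hm : m ≠ b) (hm' : Sum.inl (m + 1) ≠ v) :
      ((cycleWithTwoEars L).deleteIncidenceSet v).Reachable (Sum.inl m) (Sum.inl (m + 1)) := by
    obtain ⟨s, rfl, hs⟩ : ∃ s, segStart s = m ∧ segEnd s = m + 1 := by
      clear hm hm'; revert m; decide
    rw [← hs] at hm' ⊢
    rw [← segVertex_zero, ← segVertex_last hL]
    refine reachable_deleteIncidenceSet_segVertex L.zero_le le_rfl fun k _ hk hkv => ?_
    by_cases hk0 : k = 0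
    · exact hb _ hm (by rw [← segVertex_zero, ← hk0, hkv])
    by_cases hkL : k = L
    · exact hm' (by rw [← segVertex_last hL, ← hkv, hkL])
    · exact hm (hint s k (by omega) (by omega) hkv)
  have hne : b + 1 ≠ b ∧ b + 1 + 1 ≠ b ∧ b + 1 + 1 + 1 ≠ b := by
    clear hb hint next; revert b; decide
  have h2 := next _ hne.1 (hb _ hne.2.1)
  have h3 := h2.trans (next _ hne.2.1 (hb _ hne.2.2))
  refine ⟨b + 1, hb _ hne.1, fun m hm => ?_⟩
  obtain rfl | rfl | rfl | rfl :
      m = b + 1 ∨ m = b + 1 + 1 ∨ m = b + 1 + 1 + 1 ∨ m = b + 1 + 1 + 1 + 1 := by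
    clear hb hint next hne h2 h3 hm; revert b m; decide
  · exact .refl _
  · exact h2
  · exact h3
  · exact h3.trans (next _ hne.2.2 hm)

theorem isTwoConnected_cycleWithTwoEars (hL : 0 < L) : IsTwoConnected (cycleWithTwoEars L) := by
  refine ⟨connected_cycleWithTwoEars hL, ?_, fun v => ?_⟩
  · rw [Nat.card_sum, Nat.card_fin]
    omega
  · obtain ⟨a, ha, hreach⟩ := exists_forall_reachable_deleteIncidenceSet_junction hL v
    refine connected_induce_compl_singleton ha fun y hy => ?_
    obtain ⟨m, hm, hmy⟩ := exists_reachable_deleteIncidenceSet_junction hL hy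
    exact (hreach m hm).trans hmy

end TwoConnected

section Darts

/-- A segment together with the direction in which it is traversed: `true` stands for the direction
from the start to the end of the segment. -/
abbrev SegDart : Type := Fin 6 × Bool

namespace SegDart

/-- The same segment traversed in the opposite direction. -/
def rev (d : SegDart) : SegDart := (d.1, !d.2)

/-- The junction at which the traversal starts; it stops at `d.rev.start`. -/
def start (d : SegDart) : Fin 4 := if d.2 then segStart d.1 else segEnd d.1

/-- The vertex reached after `j ≤ M` steps of the traversal of a segment with `M` edges. -/
def vertex (M : ℕ) (d : SegDart) (j : ℕ) : EarVertex M :=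
  segVertex M d.1 (if d.2 then j else M - j)

variable {M : ℕ} {d d' : SegDart} {j j' : ℕ}

theorem rev_rev (d : SegDart) : d.rev.rev = d := by
  simp [rev]

theorem vertex_rev (d : SegDart) (hj : j ≤ M) : d.rev.vertex M j = d.vertex M (M - j) := by
  obtain ⟨s, _ | _⟩ := d <;> simp [vertex, rev, Nat.sub_sub_self hj]

theorem vertex_zero (hM : 0 < M) (d : SegDart) : d.vertex M 0 = Sum.inl d.start := by
  obtain ⟨s, _ | _⟩ := d <;> simp [vertex, start, segVertex_zero, segVertex_last hM]

theorem vertex_last (hM : 0 < M) (d : SegDart) : d.vertex M M = Sum.inl d.rev.start := by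
  rw [← vertex_zero hM, vertex_rev d M.zero_le, Nat.sub_zero]

theorem vertex_inj_of_interior (h0 : 0 < j) (hj : j < M) (hj' : j' ≤ M)
    (h : d.vertex M j = d'.vertex M j') : d' = d ∧ j' = j ∨ d' = d.rev ∧ j' = M - j := by
  obtain ⟨s, b⟩ := d
  obtain ⟨s', b'⟩ := d'
  obtain ⟨rfl, hjj'⟩ := segVertex_inj_of_interior (by grind) (by grind) (by grind) h
  cases b <;> cases b' <;> simp_all [rev] <;> omega

theorem eq_zero_of_vertex_eq_inl (hj : j < M) {m : Fin 4} (h : d.vertex M j = Sum.inl m) :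
    j = 0 ∧ d.start = m := by
  obtain ⟨s, b⟩ := d
  have := segVertex_eq_inl (by omega) (by grind) h
  cases b <;> simp_all [start] <;> omega

theorem exists_eq_vertex_of_adj {x y : EarVertex M} (h : (cycleWithTwoEars M).Adj x y) :
    ∃ (d : SegDart) (j : ℕ), j < M ∧ x = d.vertex M j ∧ y = d.vertex M (j + 1) := by
  obtain ⟨s, i, hi, ⟨rfl, rfl⟩ | ⟨rfl, rfl⟩⟩ := exists_eq_segVertex_of_adj h
  · exact ⟨(s, true), i, hi, rfl, rfl⟩
  · refine ⟨(s, false), M - (i + 1), by omega, ?_, ?_⟩ <;> simp only [vertex] <;> congr 1 <;> grind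

theorem eq_vertex_of_adj_interior (h0 : 0 < j) (hj : j < M) {y : EarVertex M}
    (h : (cycleWithTwoEars M).Adj (d.vertex M j) y) :
    y = d.vertex M (j - 1) ∨ y = d.vertex M (j + 1) := by
  obtain ⟨d', j', hj', hx, rfl⟩ := exists_eq_vertex_of_adj h
  obtain ⟨rfl, rfl⟩ | ⟨rfl, rfl⟩ := vertex_inj_of_interior h0 hj hj'.le hx
  · exact .inr rfl
  · left
    rw [vertex_rev d (by omega)]
    congr 1
    omega

theorem exists_eq_vertex_one_of_adj_junction {m : Fin 4} {y : EarVertex M}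
    (h : (cycleWithTwoEars M).Adj (Sum.inl m) y) :
    ∃ d : SegDart, d.start = m ∧ y = d.vertex M 1 := by
  obtain ⟨d, j, hj, hx, rfl⟩ := exists_eq_vertex_of_adj h
  obtain ⟨rfl, hd⟩ := eq_zero_of_vertex_eq_inl hj hx.symm
  exact ⟨d, hd, rfl⟩

theorem exists_start_eq (m : Fin 4) : ∃ d : SegDart, d.start = m := by
  revert m; decide

theorem exists_three_start_eq (m : Fin 4) :
    ∃ d : Fin 3 → SegDart, (∀ i, (d i).start = m) ∧ Function.Injective fun i => (d i).1 := by
  fin_cases m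
  · exact ⟨![(0, true), (3, false), (4, true)], by decide, by decide⟩
  · exact ⟨![(0, false), (1, true), (4, false)], by decide, by decide⟩
  · exact ⟨![(1, false), (2, true), (5, true)], by decide, by decide⟩
  · exact ⟨![(2, false), (3, true), (5, false)], by decide, by decide⟩

set_option maxRecDepth 10000 in
theorem exists_pair_start_eq_of_cover {t t' : Fin 6}
    (h : ∀ m, ∃ d : SegDart, d.start = m ∧ (d.1 = t ∨ d.1 = t')) (m : Fin 4) :
    ∃ d d' : SegDart, d.start = m ∧ d'.start = m ∧ d.1 ≠ d'.1 ∧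
      (d.1 ≠ t ∧ d.1 ≠ t') ∧ d'.1 ≠ t ∧ d'.1 ≠ t' := by
  revert t t' m; decide

theorem rev_start_eq_add_two (h : d.rev.start = d'.start) (hne : d'.rev.start ≠ d.start) :
    d'.rev.start = d.start + 2 := by
  revert d d'; decide

end SegDart

end Darts

section Ascending

variable {M : ℕ} {col : EarVertex M → ZMod 3} {d d' : SegDart} {i j : ℕ}

/-- The coloring increases by one at each step of the traversal `d`. -/
def IsAscending (col : EarVertex M → ZMod 3) (d : SegDart) : Prop :=
  ∀ j < M, ColorStep (cycleWithTwoEars M) col (d.vertex M j) (d.vertex M (j + 1))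

theorem colorStep_neg_rev_vertex (hj : j < M) :
    ColorStep (cycleWithTwoEars M) (-col) (d.rev.vertex M j) (d.rev.vertex M (j + 1)) ↔
      ColorStep (cycleWithTwoEars M) col (d.vertex M (M - 1 - j)) (d.vertex M (M - 1 - j + 1)) := by
  rw [colorStep_neg, SegDart.vertex_rev d hj.le, SegDart.vertex_rev d hj,
    show M - (j + 1) = M - 1 - j by omega, show M - 1 - j + 1 = M - j by omega]

theorem IsAscending.neg (h : IsAscending col d) : IsAscending (-col) d.rev :=
  fun j hj => (colorStep_neg_rev_vertex hj).2 (h (M - 1 - j) (by omega))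

theorem IsAscending.color_rev_start (hM : 0 < M) (h : IsAscending col d) :
    col (Sum.inl d.rev.start) = col (Sum.inl d.start) + M := by
  have (j : ℕ) (hj : j ≤ M) : col (d.vertex M j) = col (d.vertex M 0) + j := by
    induction j with
    | zero => simp
    | succ j ih => rw [(h j hj).2, ih (by omega), Nat.cast_add_one, add_assoc]
  simpa only [SegDart.vertex_zero hM, SegDart.vertex_last hM] using this M le_rfl

/-- The directed graph on the four junctions formed by the ascending traversals. -/
def JunctionStep (col : EarVertex M → ZMod 3) (a b : Fin 4) : Prop :=
  ∃ d : SegDart, d.start = a ∧ d.rev.start = b ∧ IsAscending col d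

theorem JunctionStep.color_eq (hM : 0 < M) {a b : Fin 4} (h : JunctionStep col a b) :
    col (Sum.inl b) = col (Sum.inl a) + M := by
  obtain ⟨d, rfl, rfl, hd⟩ := h
  exact hd.color_rev_start hM

theorem JunctionStep.eq_add_two (hM : ¬ 3 ∣ M) {a b e : Fin 4} (hab : JunctionStep col a b)
    (hbe : JunctionStep col b e) : e = a + 2 := by
  have hM0 : 0 < M := Nat.pos_of_ne_zero (by rintro rfl; exact hM (dvd_zero 3))
  have hne : e ≠ a := by
    rintro rfl
    refine hM ((ZMod.natCast_eq_zero_iff M 3).1 ?_)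
    have three_eq_zero : (3 : ZMod 3) = 0 := rfl
    linear_combination hab.color_eq hM0 + hbe.color_eq hM0 + (M : ZMod 3) * three_eq_zero
  obtain ⟨d, rfl, rfl, -⟩ := hab
  obtain ⟨d', hd', rfl, -⟩ := hbe
  exact SegDart.rev_start_eq_add_two hd'.symm hne

/- Any two consecutive steps lead to the opposite junction, so four steps lead back to the
starting point, while the color has changed by `4 * M`. -/
theorem wellFounded_swap_junctionStep (hM : ¬ 3 ∣ M) :
    WellFounded (Function.swap (JunctionStep col)) := by
  have hM0 : 0 < M := Nat.pos_of_ne_zero (by rintro rfl; exact hM (dvd_zero 3))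
  refine ⟨fun a => ⟨_, fun b hab => ⟨_, fun c hbc => ⟨_, fun e hce => ⟨_, fun f hef => ?_⟩⟩⟩⟩⟩
  obtain rfl : f = a := by
    rw [hce.eq_add_two hM hef, hab.eq_add_two hM hbc]
    exact (by decide : ∀ a : Fin 4, a + 2 + 2 = a) a
  refine (hM ((ZMod.natCast_eq_zero_iff M 3).1 ?_)).elim
  have three_eq_zero : (3 : ZMod 3) = 0 := rfl
  linear_combination -hab.color_eq hM0 - hbc.color_eq hM0 - hce.color_eq hM0 -
    hef.color_eq hM0 - (M : ZMod 3) * three_eq_zero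

theorem not_transGen_junctionStep_self (hM : ¬ 3 ∣ M) (a : Fin 4) :
    ¬ Relation.TransGen (JunctionStep col) a a := fun h =>
  (wellFounded_swap_junctionStep hM).transGen.irrefl.irrefl a (Relation.transGen_swap.2 h)

/-- The vertex `y` lies on a traversal that ascends up to `y` and that starts at a junction to
which ascending traversals lead from the junction `m`. -/
def ReachedFrom (col : EarVertex M → ZMod 3) (m : Fin 4) (y : EarVertex M) : Prop :=
  ∃ (d : SegDart) (j : ℕ), j < M ∧ y = d.vertex M j ∧
    Relation.ReflTransGen (JunctionStep col) m d.start ∧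
    ∀ k < j, ColorStep (cycleWithTwoEars M) col (d.vertex M k) (d.vertex M (k + 1))

theorem reachedFrom_junction (hM : 0 < M) {m m' : Fin 4}
    (h : Relation.ReflTransGen (JunctionStep col) m m') :
    ReachedFrom col m (Sum.inl m') := by
  obtain ⟨d, rfl⟩ := SegDart.exists_start_eq m'
  exact ⟨d, 0, hM, (SegDart.vertex_zero hM d).symm, h, by simp⟩

theorem ReachedFrom.of_colorReach (hM : 1 < M) {m : Fin 4} {y : EarVertex M}
    (h : ColorReach (cycleWithTwoEars M) col (Sum.inl m) y) : ReachedFrom col m y := by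
  have hM0 : 0 < M := by omega
  induction h with
  | refl => exact reachedFrom_junction hM0 .refl
  | tail _ hstep ih =>
    obtain ⟨d, j, hj, rfl, hm, hd⟩ := ih
    rcases Nat.eq_zero_or_pos j with rfl | h0
    · rw [SegDart.vertex_zero hM0] at hstep
      obtain ⟨d', hd', rfl⟩ := SegDart.exists_eq_vertex_one_of_adj_junction hstep.1
      rw [← hd'] at hm hstep
      exact ⟨d', 1, hM, rfl, hm, by simpa [SegDart.vertex_zero hM0] using hstep⟩
    rcases SegDart.eq_vertex_of_adj_interior h0 hj hstep.1 with rfl | rfl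
    · have hback := hd (j - 1) (by omega)
      rw [Nat.sub_add_cancel h0] at hback
      exact (hstep.asymm two_ne_zero_zmod_three hback).elim
    have hd' (k : ℕ) (hk : k < j + 1) :
        ColorStep (cycleWithTwoEars M) col (d.vertex M k) (d.vertex M (k + 1)) :=
      (Nat.lt_succ_iff_lt_or_eq.1 hk).elim (hd k) fun h => h ▸ hstep
    obtain hj | hj : j + 1 < M ∨ j + 1 = M := by omega
    · exact ⟨d, j + 1, hj, rfl, hm, hd'⟩
    · rw [hj, SegDart.vertex_last hM0]
      exact reachedFrom_junction hM0 (hm.tail ⟨d, rfl, rfl, hj ▸ hd'⟩)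

theorem IsAscending.not_colorReach_vertex (hM : ¬ 3 ∣ M) (hd : IsAscending col d) (h0 : 0 < i)
    (hi : i < M) :
    ¬ ColorReach (cycleWithTwoEars M) col (Sum.inl d.rev.start) (d.vertex M i) := by
  intro h
  obtain ⟨d', j, hj, hij, hreach, hd'⟩ := ReachedFrom.of_colorReach (by omega) h
  obtain ⟨rfl, rfl⟩ | ⟨rfl, rfl⟩ := SegDart.vertex_inj_of_interior h0 hi hj.le hij
  · exact not_transGen_junctionStep_self hM _ (.head' ⟨d', rfl, rfl, hd⟩ hreach)
  · have hdown := colorStep_neg.1 (hd.neg 0 (by omega))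
    exact hdown.asymm two_ne_zero_zmod_three (hd' 0 (by omega))

theorem IsAscending.eq_vertex_or_colorReach (hd : IsAscending col d) (h0 : 0 < i)
    (hi : i < M) {y : EarVertex M} (h : ColorReach (cycleWithTwoEars M) col (d.vertex M i) y) :
    (∃ j, 0 < j ∧ j < M ∧ y = d.vertex M j) ∨
      ColorReach (cycleWithTwoEars M) col (Sum.inl d.rev.start) y := by
  induction h with
  | refl => exact .inl ⟨i, h0, hi, rfl⟩
  | tail _ hstep ih =>
    rcases ih with ⟨j, h0, hj, rfl⟩ | hreach
    · rcases SegDart.eq_vertex_of_adj_interior h0 hj hstep.1 with rfl | rfl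
      · have hback := hd (j - 1) (by omega)
        rw [Nat.sub_add_cancel h0] at hback
        exact (hstep.asymm two_ne_zero_zmod_three hback).elim
      obtain hj | hj : j + 1 < M ∨ j + 1 = M := by omega
      · exact .inl ⟨j + 1, by omega, hj, rfl⟩
      · rw [hj, SegDart.vertex_last (by omega)]
        exact .inr .refl
    · exact .inr (hreach.tail hstep)

theorem IsAscending.not_colorReach_of_rev_start_eq (hM : ¬ 3 ∣ M) (hd : IsAscending col d)
    (hd' : IsAscending col d') (hend : d.rev.start = d'.rev.start) (hne : d.1 ≠ d'.1)
    (hi0 : 0 < i) (hi : i < M) (hj0 : 0 < j) (hj : j < M) :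
    ¬ ColorReach (cycleWithTwoEars M) col (d.vertex M i) (d'.vertex M j) := by
  intro h
  rcases hd.eq_vertex_or_colorReach hi0 hi h with ⟨k, -, hk, hjk⟩ | hreach
  · rcases SegDart.vertex_inj_of_interior hj0 hj hk.le hjk with ⟨rfl, -⟩ | ⟨rfl, -⟩ <;>
      exact hne rfl
  · rw [hend] at hreach
    exact hd'.not_colorReach_vertex hM hj0 hj hreach

end Ascending

section Comparable

variable {M : ℕ} {col : EarVertex M → ZMod 3} {d d' : SegDart} {i : ℕ}

/-- Any two traversals of different segments contain, within three steps from their starts,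
vertices one of which is reachable from the other along increasing colors. -/
def NearStartsComparable (col : EarVertex M → ZMod 3) : Prop :=
  ∀ d d' : SegDart, d.1 ≠ d'.1 → ∃ i j, (0 < i ∧ i ≤ 3) ∧ (0 < j ∧ j ≤ 3) ∧
    (ColorReach (cycleWithTwoEars M) col (d.vertex M i) (d'.vertex M j) ∨
      ColorReach (cycleWithTwoEars M) col (d'.vertex M j) (d.vertex M i))

theorem NearStartsComparable.neg (h : NearStartsComparable col) : NearStartsComparable (-col) := by
  intro d d' hne
  obtain ⟨i, j, hi, hj, hij⟩ := h d d' hne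
  exact ⟨i, j, hi, hj, hij.symm.imp colorReach_neg.2 colorReach_neg.2⟩

theorem NearStartsComparable.eq_of_rev_start_eq (hcol : NearStartsComparable col) (hM : 3 < M)
    (h3 : ¬ 3 ∣ M) (hd : IsAscending col d) (hd' : IsAscending col d')
    (h : d.rev.start = d'.rev.start) : d.1 = d'.1 := by
  by_contra hne
  obtain ⟨i, j, hi, hj, hij | hji⟩ := hcol d d' hne
  · exact hd.not_colorReach_of_rev_start_eq h3 hd' h hne hi.1 (by omega) hj.1 (by omega) hij
  · exact hd'.not_colorReach_of_rev_start_eq h3 hd h.symm (Ne.symm hne) hj.1 (by omega) hi.1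
      (by omega) hji

theorem NearStartsComparable.eq_of_start_eq (hcol : NearStartsComparable col) (hM : 3 < M)
    (h3 : ¬ 3 ∣ M) (hd : IsAscending col d) (hd' : IsAscending col d')
    (h : d.start = d'.start) : d.1 = d'.1 :=
  hcol.neg.eq_of_rev_start_eq (d := d.rev) (d' := d'.rev) hM h3 hd.neg hd'.neg
    (by simpa only [SegDart.rev_rev] using h)

theorem NearStartsComparable.exists_not_ascending (hcol : NearStartsComparable col) (hM : 3 < M)
    (h3 : ¬ 3 ∣ M) (m : Fin 4) :
    ∃ d : SegDart, d.start = m ∧ ¬ IsAscending col d ∧ ¬ IsAscending col d.rev := by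
  by_contra! h
  obtain ⟨d, hd, hinj⟩ := SegDart.exists_three_start_eq m
  obtain ⟨i, j, hij, heq⟩ := Fintype.exists_ne_map_eq_of_card_lt
    (fun i => IsAscending col (d i)) (by simp)
  have hstart : (d i).start = (d j).start := (hd i).trans (hd j).symm
  by_cases hi : IsAscending col (d i)
  · exact hij (hinj (hcol.eq_of_start_eq hM h3 hi (heq ▸ hi) hstart))
  · have hj : ¬ IsAscending col (d j) := heq ▸ hi
    exact hij (hinj (hcol.eq_of_rev_start_eq (d := (d i).rev) (d' := (d j).rev) hM h3
      (h _ (hd i) hi) (h _ (hd j) hj) (by simpa only [SegDart.rev_rev] using hstart)))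

/-- Walks of increasing colors that start within three steps from the start of the traversal `d`
never leave the interior of its segment. -/
def IsTrapped (col : EarVertex M → ZMod 3) (d : SegDart) : Prop :=
  ∀ i, 0 < i → i ≤ 3 → ∀ y, ColorReach (cycleWithTwoEars M) col (d.vertex M i) y →
    ∃ j, 0 < j ∧ j < M ∧ y = d.vertex M j

theorem IsTrapped.not_colorReach (hM : 3 < M) (hd : IsTrapped col d) (hne : d.1 ≠ d'.1) {j : ℕ}
    (hi : 0 < i ∧ i ≤ 3) (hj : 0 < j ∧ j ≤ 3) :
    ¬ ColorReach (cycleWithTwoEars M) col (d.vertex M i) (d'.vertex M j) := by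
  intro h
  obtain ⟨k, -, hk, hjk⟩ := hd i hi.1 hi.2 _ h
  rcases SegDart.vertex_inj_of_interior hj.1 (by omega) hk.le hjk with ⟨rfl, -⟩ | ⟨rfl, -⟩ <;>
    exact hne rfl

theorem NearStartsComparable.eq_of_isTrapped (hcol : NearStartsComparable col) (hM : 3 < M)
    (hd : IsTrapped col d) (hd' : IsTrapped col d') : d.1 = d'.1 := by
  by_contra hne
  obtain ⟨i, j, hi, hj, hij | hji⟩ := hcol d d' hne
  · exact hd.not_colorReach hM hne hi hj hij
  · exact hd'.not_colorReach hM (Ne.symm hne) hj hi hji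

theorem isTrapped_of_not_colorStep (hi3 : 3 ≤ i) (hiM : i + 2 ≤ M)
    (hstart : ¬ ColorStep (cycleWithTwoEars M) col (d.vertex M 1) (d.vertex M 0))
    (hi : ColorStep (cycleWithTwoEars M) col (d.vertex M i) (d.vertex M (i + 1)) →
      ¬ ColorStep (cycleWithTwoEars M) col (d.vertex M (i + 1)) (d.vertex M (i + 2))) :
    IsTrapped col d := by
  intro k hk0 hk3 y h
  suffices hy : (∃ j, 0 < j ∧ j ≤ i ∧ y = d.vertex M j) ∨ y = d.vertex M (i + 1) ∧
      ColorStep (cycleWithTwoEars M) col (d.vertex M i) (d.vertex M (i + 1)) by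
    rcases hy with ⟨j, h0, hj, rfl⟩ | ⟨rfl, -⟩
    exacts [⟨j, h0, by omega, rfl⟩, ⟨i + 1, by omega, by omega, rfl⟩]
  induction h with
  | refl => exact .inl ⟨k, hk0, by omega, rfl⟩
  | tail _ hstep ih =>
    rcases ih with ⟨j, h0, hj, rfl⟩ | ⟨rfl, hup⟩
    · rcases SegDart.eq_vertex_of_adj_interior h0 (by omega) hstep.1 with rfl | rfl
      · obtain rfl | h1 : j = 1 ∨ 1 < j := by omega
        · exact (hstart hstep).elim
        · exact .inl ⟨j - 1, by omega, by omega, rfl⟩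
      · rcases hj.eq_or_lt with rfl | hj
        · exact .inr ⟨rfl, hstep⟩
        · exact .inl ⟨j + 1, by omega, hj, rfl⟩
    · rcases SegDart.eq_vertex_of_adj_interior i.succ_pos (by omega) hstep.1 with rfl | rfl
      · exact (hup.asymm two_ne_zero_zmod_three hstep).elim
      · exact (hi hup hstep).elim

end Comparable

section Monotone

variable {M : ℕ} {col : EarVertex M → ZMod 3} {d : SegDart} {i : ℕ}

theorem exists_isTrapped_of_turn (hi3 : 3 ≤ i) (hiM : i + 2 ≤ M)
    (hup : ColorStep (cycleWithTwoEars M) col (d.vertex M i) (d.vertex M (i + 1)) →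
      ¬ ColorStep (cycleWithTwoEars M) col (d.vertex M (i + 1)) (d.vertex M (i + 2)))
    (hdown : ColorStep (cycleWithTwoEars M) col (d.vertex M (i + 1)) (d.vertex M i) →
      ¬ ColorStep (cycleWithTwoEars M) col (d.vertex M (i + 2)) (d.vertex M (i + 1))) :
    IsTrapped col d ∨ IsTrapped (-col) d := by
  by_cases hstart : ColorStep (cycleWithTwoEars M) col (d.vertex M 1) (d.vertex M 0)
  · exact .inr (isTrapped_of_not_colorStep hi3 hiM
      (fun h => hstart.asymm two_ne_zero_zmod_three (colorStep_neg.1 h))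
      fun h h' => hdown (colorStep_neg.1 h) (colorStep_neg.1 h'))
  · exact .inl (isTrapped_of_not_colorStep hi3 hiM hstart hup)

theorem isAscending_or_isAscending_rev_of_forall (hM : M ≠ 1)
    (h : ∀ i, i + 1 < M →
      ColorStep (cycleWithTwoEars M) col (d.vertex M i) (d.vertex M (i + 1)) ∧
        ColorStep (cycleWithTwoEars M) col (d.vertex M (i + 1)) (d.vertex M (i + 2)) ∨
      ColorStep (cycleWithTwoEars M) col (d.vertex M (i + 1)) (d.vertex M i) ∧
        ColorStep (cycleWithTwoEars M) col (d.vertex M (i + 2)) (d.vertex M (i + 1))) :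
    IsAscending col d ∨ IsAscending col d.rev := by
  refine (forall_or_forall_of_consecutive hM
    (fun i h => h.1.asymm two_ne_zero_zmod_three h.2) h).imp_right fun hdown => ?_
  have hneg : IsAscending (-col) d := fun j hj => colorStep_neg.2 (hdown j hj)
  simpa only [neg_neg] using hneg.neg

/- The turn is at distance at least three from one of the two ends of the segment. -/
theorem exists_isTrapped_of_not_ascending (hM : 7 ≤ M) (hd : ¬ IsAscending col d)
    (hd' : ¬ IsAscending col d.rev) :
    ∃ e : SegDart, e.1 = d.1 ∧ (IsTrapped col e ∨ IsTrapped (-col) e) := by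
  have hturn := mt (isAscending_or_isAscending_rev_of_forall (by omega)) (not_or_intro hd hd')
  push Not at hturn
  obtain ⟨i, hi, hup, hdown⟩ := hturn
  obtain hi3 | hi3 : 3 ≤ i ∨ 3 ≤ M - (i + 2) := by omega
  · exact ⟨d, rfl, exists_isTrapped_of_turn hi3 hi hup hdown⟩
  · refine ⟨d.rev, rfl, exists_isTrapped_of_turn hi3 (by omega) ?_ ?_⟩ <;>
      rw [show M - (i + 2) + 1 = M - (i + 1) by omega, show M - (i + 2) + 2 = M - i by omega,
        SegDart.vertex_rev d (by omega), SegDart.vertex_rev d (by omega),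
        SegDart.vertex_rev d (by omega), Nat.sub_sub_self (by omega), Nat.sub_sub_self (by omega),
        Nat.sub_sub_self (by omega)]
    exacts [fun h h' => hdown h' h, fun h h' => hup h' h]

theorem NearStartsComparable.exists_forall_isTrapped (hcol : NearStartsComparable col)
    (hM : 3 < M) : ∃ t : Fin 6, ∀ d, IsTrapped col d → d.1 = t := by
  by_cases h : ∃ e, IsTrapped col e
  · obtain ⟨e, he⟩ := h
    exact ⟨e.1, fun d hd => hcol.eq_of_isTrapped hM hd he⟩
  · exact ⟨0, fun d hd => (h ⟨d, hd⟩).elim⟩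

theorem NearStartsComparable.exists_forall_ascending (hcol : NearStartsComparable col)
    (hM : 7 ≤ M) : ∃ t t' : Fin 6, ∀ d : SegDart, d.1 ≠ t → d.1 ≠ t' →
      IsAscending col d ∨ IsAscending col d.rev := by
  obtain ⟨t, ht⟩ := hcol.exists_forall_isTrapped (by omega)
  obtain ⟨t', ht'⟩ := hcol.neg.exists_forall_isTrapped (by omega)
  refine ⟨t, t', fun d hdt hdt' => ?_⟩
  by_contra! hd
  obtain ⟨e, he, htrap | htrap⟩ := exists_isTrapped_of_not_ascending hM hd.1 hd.2
  · exact hdt (he ▸ ht e htrap)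
  · exact hdt' (he ▸ ht' e htrap)

theorem NearStartsComparable.exists_junctionStep (hcol : NearStartsComparable col) (hM : 7 ≤ M)
    (h3 : ¬ 3 ∣ M) (m : Fin 4) : ∃ m', JunctionStep col m m' := by
  obtain ⟨t, t', hmono⟩ := hcol.exists_forall_ascending hM
  have hcover (m : Fin 4) : ∃ d : SegDart, d.start = m ∧ (d.1 = t ∨ d.1 = t') := by
    obtain ⟨d, hd, hup, hdown⟩ := hcol.exists_not_ascending (by omega) h3 m
    refine ⟨d, hd, ?_⟩
    by_contra! hne
    exact (hmono d hne.1 hne.2).elim hup hdown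
  obtain ⟨d, d', rfl, hd', hne, hdt, hdt'⟩ := SegDart.exists_pair_start_eq_of_cover hcover m
  rcases hmono d hdt.1 hdt.2 with hd | hd
  · exact ⟨_, d, rfl, rfl, hd⟩
  rcases hmono d' hdt'.1 hdt'.2 with hd'' | hd''
  · exact ⟨_, d', hd', rfl, hd''⟩
  · exact (hne (hcol.eq_of_rev_start_eq (d := d.rev) (d' := d'.rev) (by omega) h3 hd hd''
      (by simpa only [SegDart.rev_rev] using hd'.symm))).elim

theorem not_nearStartsComparable (hM : 7 ≤ M) (h3 : ¬ 3 ∣ M) : ¬ NearStartsComparable col := by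
  intro hcol
  obtain ⟨m, -, hm⟩ :=
    (wellFounded_swap_junctionStep (col := col) h3).has_min Set.univ ⟨0, trivial⟩
  obtain ⟨m', hm'⟩ := hcol.exists_junctionStep hM h3 m
  exact hm m' trivial hm'

end Monotone

section Subdivision

variable {L : ℕ} {α : Type*} {cv : EarVertex L → α} {ce : Sym2 (EarVertex L) → α}

/-- The embedding of the vertices into the subdivision in which every edge is replaced by a path of
two edges, realized as the graph with segments of twice the length. -/
def subdivisionVertex (L : ℕ) : EarVertex L → EarVertex (2 * L) :=
  Sum.map id fun x => (x.1, ⟨2 * x.2 + 1, by omega⟩)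

/-- The vertex coloring of the subdivision induced by a total-coloring: old vertices keep their
colors and the midpoint of an edge gets the color of the edge. The vertex with index `k` inside a
segment is the one at distance `k + 1` from its start, hence the midpoint of an edge for even `k`.
-/
def subdivisionColor (cv : EarVertex L → α) (ce : Sym2 (EarVertex L) → α) :
    EarVertex (2 * L) → α :=
  Sum.elim (fun m => cv (Sum.inl m)) fun x =>
    if Even (x.2 : ℕ) then ce s(segVertex L x.1 (x.2 / 2), segVertex L x.1 (x.2 / 2 + 1))
    else cv (segVertex L x.1 (x.2 / 2 + 1))

theorem subdivisionVertex_segVertex (hL : 0 < L) (s : Fin 6) {i : ℕ} (hi : i ≤ L) :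
    subdivisionVertex L (segVertex L s i) = segVertex (2 * L) s (2 * i) := by
  rcases i with _ | i
  · simp [segVertex_zero, subdivisionVertex]
  rcases hi.eq_or_lt with rfl | hi
  · simp [segVertex_last, subdivisionVertex]
  · rw [segVertex_succ hi, Nat.mul_succ, segVertex_succ (by omega)]
    rfl

theorem subdivisionVertex_vertex (hL : 0 < L) (d : SegDart) {j : ℕ} (hj : j ≤ L) :
    subdivisionVertex L (d.vertex L j) = d.vertex (2 * L) (2 * j) := by
  obtain ⟨s, _ | _⟩ := d
  · simpa [SegDart.vertex, Nat.mul_sub] using subdivisionVertex_segVertex hL s (L.sub_le j)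
  · exact subdivisionVertex_segVertex hL s hj

theorem subdivisionColor_subdivisionVertex (x : EarVertex L) :
    subdivisionColor cv ce (subdivisionVertex L x) = cv x := by
  rcases x with m | ⟨s, i⟩
  · rfl
  · have hi : (2 * (i : ℕ) + 1) / 2 = i := by omega
    simp [subdivisionVertex, subdivisionColor, hi, segVertex_succ (show (i : ℕ) + 1 < L by omega)]

theorem subdivisionColor_midpoint (s : Fin 6) {i : ℕ} (hi : i < L) :
    subdivisionColor cv ce (segVertex (2 * L) s (2 * i + 1)) =
      ce s(segVertex L s i, segVertex L s (i + 1)) := by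
  rw [segVertex_succ (by omega)]
  simp [subdivisionColor]

theorem exists_midpoint_of_adj (cv : EarVertex L → α) (ce : Sym2 (EarVertex L) → α)
    {x y : EarVertex L} (h : (cycleWithTwoEars L).Adj x y) :
    ∃ e : EarVertex (2 * L), (cycleWithTwoEars (2 * L)).Adj (subdivisionVertex L x) e ∧
      (cycleWithTwoEars (2 * L)).Adj e (subdivisionVertex L y) ∧
      subdivisionColor cv ce e = ce s(x, y) := by
  obtain ⟨s, i, hi, h⟩ := exists_eq_segVertex_of_adj h
  have hfst := adj_segVertex s (show 2 * i < 2 * L by omega)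
  have hsnd := adj_segVertex s (show 2 * i + 1 < 2 * L by omega)
  rw [show 2 * i + 1 + 1 = 2 * (i + 1) by ring] at hsnd
  rw [← subdivisionVertex_segVertex (by omega) s hi.le] at hfst
  rw [← subdivisionVertex_segVertex (by omega) s hi] at hsnd
  refine ⟨segVertex (2 * L) s (2 * i + 1), ?_⟩
  rcases h with ⟨rfl, rfl⟩ | ⟨rfl, rfl⟩
  · exact ⟨hfst, hsnd, subdivisionColor_midpoint s hi⟩
  · exact ⟨hsnd.symm, hfst.symm, Sym2.eq_swap ▸ subdivisionColor_midpoint s hi⟩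

theorem exists_subdivision_of_walk (cv : EarVertex L → α) (ce : Sym2 (EarVertex L) → α)
    {x y : EarVertex L} (p : (cycleWithTwoEars L).Walk x y) :
    ∃ g : ℕ → EarVertex (2 * L), (∀ i, g (2 * i) = subdivisionVertex L (p.getVert i)) ∧
      (∀ j < 2 * p.length, (cycleWithTwoEars (2 * L)).Adj (g j) (g (j + 1))) ∧
      ∀ i < p.length,
        subdivisionColor cv ce (g (2 * i + 1)) = ce s(p.getVert i, p.getVert (i + 1)) := by
  have := Nonempty.intro (subdivisionVertex L x)
  choose! mid hfst hsnd hmid using fun i (hi : i < p.length) =>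
    exists_midpoint_of_adj cv ce (p.adj_getVert_succ hi)
  let g (j : ℕ) : EarVertex (2 * L) :=
    if Even j then subdivisionVertex L (p.getVert (j / 2)) else mid (j / 2)
  have g_even (i : ℕ) : g (2 * i) = subdivisionVertex L (p.getVert i) := by simp [g]
  have g_odd (i : ℕ) : g (2 * i + 1) = mid i := by simp [g, show (2 * i + 1) / 2 = i by omega]
  refine ⟨g, g_even, fun j hj => ?_, fun i hi => g_odd i ▸ hmid i hi⟩
  obtain ⟨i, rfl | rfl⟩ := j.even_or_odd'
  · rw [g_even, g_odd]
    exact hfst i (by omega)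
  · rw [g_odd, show 2 * i + 1 + 1 = 2 * (i + 1) by ring, g_even]
    exact hsnd i (by omega)

theorem IsTotalProperPath.exists_colorReach {cv : EarVertex L → ZMod 3}
    {ce : Sym2 (EarVertex L) → ZMod 3} {x y : EarVertex L} {p : (cycleWithTwoEars L).Walk x y}
    (hp : IsTotalProperPath (cycleWithTwoEars L) cv ce p) (hxy : x ≠ y) :
    ∃ a b, (cycleWithTwoEars (2 * L)).Adj (subdivisionVertex L x) a ∧
      (cycleWithTwoEars (2 * L)).Adj (subdivisionVertex L y) b ∧
      (ColorReach (cycleWithTwoEars (2 * L)) (subdivisionColor cv ce) a b ∨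
        ColorReach (cycleWithTwoEars (2 * L)) (subdivisionColor cv ce) b a) := by
  have hlen : 0 < p.length := by
    by_contra h
    exact hxy (p.eq_of_length_eq_zero (by omega))
  obtain ⟨g, hvert, hadj, hedge⟩ := exists_subdivision_of_walk cv ce p
  obtain ⟨n, hn⟩ := Nat.exists_eq_add_one.2 hlen
  refine ⟨g 1, g (2 * n + 1), ?_, ?_, colorReach_or_colorReach_of_forall_ne
    (g := fun j => g (j + 1)) (n := 2 * n) (by omega) (fun j hj => hadj (j + 1) (by omega)) ?_⟩
  · simpa only [mul_zero, hvert 0, p.getVert_zero] using hadj 0 (by omega)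
  · have := (hadj (2 * n + 1) (by omega)).symm
    rwa [show 2 * n + 1 + 1 = 2 * p.length by omega, hvert, p.getVert_length] at this
  · intro j hj
    have hvert_color (i : ℕ) : subdivisionColor cv ce (g (2 * i)) = cv (p.getVert i) := by
      rw [hvert, subdivisionColor_subdivisionVertex]
    obtain ⟨i, rfl | rfl⟩ := j.even_or_odd'
    · have hi : i + 2 ≤ p.length := by omega
      rw [show 2 * i + 1 + 1 = 2 * (i + 1) by ring, hedge i (by omega),
        hedge (i + 1) (by omega), hvert_color]
      exact ⟨(hp.vert_ne_edge i hi).1.symm, (hp.vert_ne_edge i hi).2, hp.edge_ne_edge i hi⟩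
    · have hi : i + 1 + 2 ≤ p.length := by omega
      rw [show 2 * i + 1 + 1 = 2 * (i + 1) by ring,
        show 2 * i + 1 + 2 + 1 = 2 * (i + 1 + 1) by ring,
        hedge (i + 1) (by omega), hvert_color, hvert_color]
      exact ⟨(hp.vert_ne_edge i (by omega)).2, (hp.vert_ne_edge (i + 1) hi).1.symm,
        hp.vert_ne_vert (i + 1) i.succ_pos hi⟩

theorem IsTotalProperConnected.nearStartsComparable {cv : EarVertex L → ZMod 3}
    {ce : Sym2 (EarVertex L) → ZMod 3} (hL : 2 ≤ L)
    (h : IsTotalProperConnected (cycleWithTwoEars L) cv ce) :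
    NearStartsComparable (subdivisionColor cv ce) := by
  intro d d' hne
  obtain ⟨p, hp⟩ := h (d.vertex L 1) (d'.vertex L 1)
  have hxy : d.vertex L 1 ≠ d'.vertex L 1 := by
    intro hxy
    rcases SegDart.vertex_inj_of_interior one_pos hL (by omega) hxy with ⟨rfl, -⟩ | ⟨rfl, -⟩ <;>
      exact hne rfl
  have near (e : SegDart) {a : EarVertex (2 * L)}
      (ha : (cycleWithTwoEars (2 * L)).Adj (subdivisionVertex L (e.vertex L 1)) a) :
      ∃ i, (0 < i ∧ i ≤ 3) ∧ a = e.vertex (2 * L) i := by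
    rw [subdivisionVertex_vertex (by omega) e (by omega)] at ha
    exact (SegDart.eq_vertex_of_adj_interior (by omega) (by omega) ha).elim
      (fun h => ⟨1, by omega, h⟩) fun h => ⟨3, by omega, h⟩
  obtain ⟨a, b, ha, hb, hab⟩ := hp.exists_colorReach hxy
  obtain ⟨i, hi, rfl⟩ := near d ha
  obtain ⟨j, hj, rfl⟩ := near d' hb
  exact ⟨i, j, hi, hj, hab⟩

end Subdivision

theorem not_isTotalProperConnected {L n : ℕ} (hL : 4 ≤ L) (h3 : ¬ 3 ∣ L) (hn : n ≤ 3)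
    (cv : EarVertex L → Fin n) (ce : Sym2 (EarVertex L) → Fin n) :
    ¬ IsTotalProperConnected (cycleWithTwoEars L) cv ce := by
  intro h
  have hcol : IsTotalProperConnected (cycleWithTwoEars L) (α := ZMod 3) _ _ :=
    h.comp_injective (Fin.castLE_injective hn)
  exact not_nearStartsComparable (by omega) (by omega) (hcol.nearStartsComparable (by omega))

theorem tpc_cycleWithTwoEars {L : ℕ} (hL : 4 ≤ L) (h3 : ¬ 3 ∣ L) :
    tpc (cycleWithTwoEars L) = 4 := by
  have h4 : ∃ (cv : EarVertex L → Fin 4) (ce : Sym2 (EarVertex L) → Fin 4),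
      IsTotalProperConnected (cycleWithTwoEars L) cv ce :=
    ⟨_, _, isTotalProperConnected_of_colorReach (R := ZMod 4) (by decide)
      (colorReach_phase (by omega))⟩
  refine le_antisymm (Nat.sInf_le h4) (le_csInf ⟨4, h4⟩ ?_)
  rintro n ⟨cv, ce, h⟩
  by_contra hn
  exact not_isTotalProperConnected hL h3 (by omega) cv ce h

end TotalProper

theorem proposition3_general {L : ℕ} (hL : 4 ≤ L) (h3 : ¬ 3 ∣ L) :
    TotalProper.IsTwoConnected (TotalProper.cycleWithTwoEars L) ∧
    (TotalProper.cycleWithTwoEars L).IsBipartite ∧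
    TotalProper.tpc (TotalProper.cycleWithTwoEars L) = 4 :=
  ⟨TotalProper.isTwoConnected_cycleWithTwoEars (by omega),
    TotalProper.isBipartite_cycleWithTwoEars L, TotalProper.tpc_cycleWithTwoEars hL h3⟩

theorem proposition3 (k : ℕ) (hk : 2 ≤ k) :
    TotalProper.IsTwoConnected (TotalProper.cycleWithTwoEars (2 ^ k)) ∧
    (TotalProper.cycleWithTwoEars (2 ^ k)).IsBipartite ∧
    TotalProper.tpc (TotalProper.cycleWithTwoEars (2 ^ k)) = 4 :=
  proposition3_general (Nat.pow_le_pow_right two_pos hk)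
    fun h => absurd (Nat.prime_three.dvd_of_dvd_pow h) (by decide)
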